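/- **Theorem (privacy against malicious Bob).** *Conventions.* $n$ is the security parameter. A function $\varepsilon(n)$ is negligible if it vanishes faster than every inverse polynomial. QPT means non-uniform quantum polynomial time: a family of polynomial-size quantum circuits acting on polynomially many qubits, some of which may initially hold an arbitrary auxiliary quantum state depending on $n$. *The function family.* Let $\mathcal F=\{f_k:\{0,1\}^{d(n)}\to\{0,1\}^{\ell(n)}\}$ be a 2-regular trapdoor one-way family with a homomorphic hardcore predicate $\{h_k\}$. That is, there is a PPT key generator $\mathrm{Gen}_{\mathcal F}(1^n)\to(k,t_k,hp)$, where $k$ is the public key, $t_k$ the trapdoor and $hp$ a bit, such that: 1. $f_k$ and $h_k:\{0,1\}^{d(n)}\to\{0,1\}$ are computable in polynomial time from $k$ and the argument; 2. with overwhelming probability over the key and a uniform $x$, $f_k(x)$ has exactly two preimages (in particular this holds if every $f_k$ is exactly 2-regular); 3. every QPT algorithm that is given $(k,f_k(x))$, for a random key and a uniform $x$, outputs a preimage of $f_k(x)$ with negligible probability only; 4. a PPT algorithm $\mathrm{Inv}$, given $(t_k,f_k(x))$, returns all preimages of $f_k(x)$ with overwhelming probability over the key, a uniform $x$ and its own coins;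 5. (homomorphic) except with negligible probability over the key and a uniform $x$, every $x'\neq x$ with $f_k(x')=f_k(x)$ satisfies $h_k(x)\oplus h_k(x')=hp$; 6. (hardcore) every QPT algorithm that is given only $k$ outputs $hp$ with probability at most $\tfrac12+\mathrm{negl}(n)$. *The protocol $\pi_{SH}$* (classical Alice with input $b\in\{0,1\}$, quantum Bob, classical channel). Alice runs $(k,t_k,hp)\leftarrow\mathrm{Gen}_{\mathcal F}(1^n)$, sets $\theta_2:=hp$ (the basis bit of the QFactory remote state preparation) and sends $k$. Bob answers with $(y,m)\in\{0,1\}^{\ell(n)}\times\{0,1\}^{d(n)}$. Alice samples a uniform bit $r_A$ and sends $\delta=b+\theta_2+2r_A \bmod 4$ (an angle in units of $\pi/2$). Bob answers with two bits $(m_0,\bar s)$. Alice computes the preimages $x,x'$ of $y$ with the trapdoor, sets $\theta_1=\theta_2\cdot\langle m,x\oplus x'\rangle\oplus h_k(x)h_k(x')$ and outputs $\bar s\oplus\theta_1\oplus r_A\oplus m_0 b$. *Claim.* $\pi_{SH}$ is private against malicious Bob: for every malicious QPT Bob$^*$ with an arbitrary auxiliary input $z$, $$\{\mathrm{view}_{\mathrm{Bob}^*}(\mathrm{Bob}^*(z),\mathrm{Alice}(0))\}_n\;\approx_q\;\{\mathrm{view}_{\mathrm{Bob}^*}(\mathrm{Bob}^*(z),\mathrm{Alice}(1))\}_n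 .$$ Here the view consists of the messages $(k,\delta)$ that Bob$^*$ receives together with his whole internal quantum register at the end of the execution (which includes his auxiliary input and randomness as far as he keeps them). The relation $\approx_q$ means that for every QPT distinguisher $D$ with one output bit, the difference between the probabilities that $D$ outputs $1$ on the two views is negligible in $n$. -/

import Mathlib

open scoped Matrix ComplexOrder

noncomputable section

namespace OQFE

/-! ### Bit strings, polynomial bounds, negligible functions -/

/-- Bit strings of length `n`. -/
abbrev Bits (n : ℕ) : Type := Fin n → Bool

/-- `f` is bounded by a polynomial in the security parameter. -/
def PolyBounded (f : ℕ → ℕ) : Prop :=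
  ∃ p : Polynomial ℕ, ∀ n, f n ≤ p.eval n

/-- Negligible functions: they decay faster than every inverse polynomial. -/
def Negligible (ε : ℕ → ℝ) : Prop :=
  Asymptotics.SuperpolynomialDecay Filter.atTop (fun n : ℕ => (n : ℝ)) ε

/-- The average of `g` over the uniform distribution on a finite type. -/
def average {Ω : Type} [Fintype Ω] (g : Ω → ℝ) : ℝ :=
  (Fintype.card Ω : ℝ)⁻¹ * ∑ ω, g ω

open Classical in
/-- The probability of an event under the uniform distribution on a finite type. -/
def uniformProb {Ω : Type} [Fintype Ω] (E : Ω → Prop) : ℝ :=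
  average fun ω => if E ω then 1 else 0

/-- Functions on strings that a Turing machine computes in polynomial time. -/
def PolyTime (φ : List Bool → List Bool) : Prop :=
  Nonempty (Turing.TM2ComputableInPolyTime (id : List Bool → List Bool)
    (id : List Bool → List Bool) φ)

/-- The string `1ⁿ0` in front of the inputs of the polynomial-time algorithms. -/
def unary (n : ℕ) : List Bool := List.replicate n true ++ [false]

/-! ### Quantum circuits

A circuit acts on qubits ("wires") indexed by `ι` and can read a classical input of `c` bits.
States of the wires are density matrices indexed by the computational basis `ι → Bool`. -/

/-- Matrices over the computational basis of the wires `ι`. -/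
abbrev Op (ι : Type) : Type := Matrix (ι → Bool) (ι → Bool) ℂ

/-- Elementary operations: a universal gate set, reading a classical bit, and measurement. -/
inductive Gate (c : ℕ) (ι : Type) : Type
  /-- Pauli `X` -/
  | x (i : ι)
  /-- Hadamard gate -/
  | h (i : ι)
  /-- `T` gate, i.e. `diag (1, e^{iπ/4})` -/
  | t (i : ι)
  /-- controlled not, with control `i` and target `j` -/
  | cnot (i j : ι) (hij : i ≠ j)
  /-- apply `X` to wire `i` if bit `a` of the classical input is one -/
  | read (a : Fin c) (i : ι)
  /-- measure wire `i` in the computational basis; the wire then holds the outcome -/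
  | meas (i : ι)

/-- A circuit is the list of its operations, in the order of execution; its size is the length. -/
abbrev Circuit (c : ℕ) (ι : Type) : Type := List (Gate c ι)

def pauliX : Matrix Bool Bool ℂ := fun a b => if a = b then 0 else 1

def hadamard : Matrix Bool Bool ℂ := fun a b =>
  if a = true ∧ b = true then -((Real.sqrt 2 : ℂ)⁻¹) else (Real.sqrt 2 : ℂ)⁻¹

def tGate : Matrix Bool Bool ℂ := fun a b =>
  if a = b then (if a = true then Complex.exp (Complex.I * Real.pi / 4) else 1) else 0

section Semantics

variable {ι : Type} [Fintype ι] [DecidableEq ι]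

/-- The one-qubit operator `u` on wire `i`, tensored with the identity on the other wires. -/
def onWire (u : Matrix Bool Bool ℂ) (i : ι) : Op ι := fun x y =>
  if ∀ j, j ≠ i → x j = y j then u (x i) (y i) else 0

/-- The unitary `|y⟩ ↦ |y with y_j replaced by y_j ⊕ y_i⟩`. -/
def cnotOp (i j : ι) : Op ι := fun x y =>
  if x = Function.update y j (xor (y j) (y i)) then 1 else 0

/-- Conjugation `ρ ↦ U ρ U†`. -/
def conj (U ρ : Op ι) : Op ι := U * ρ * Uᴴ

/-- The effect of one operation on a density matrix, for the classical input `inp`. -/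
def Gate.apply {c : ℕ} (inp : Bits c) : Gate c ι → Op ι → Op ι
  | .x i, ρ => conj (onWire pauliX i) ρ
  | .h i, ρ => conj (onWire hadamard i) ρ
  | .t i, ρ => conj (onWire tGate i) ρ
  | .cnot i j _, ρ => conj (cnotOp i j) ρ
  | .read a i, ρ => if inp a = true then conj (onWire pauliX i) ρ else ρ
  | .meas i, ρ => fun x y => if x i = y i then ρ x y else 0

/-- The effect of a circuit on a density matrix, for the classical input `inp`. -/
def Circuit.run {c : ℕ} (C : Circuit c ι) (inp : Bits c) (ρ : Op ι) : Op ι :=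
  C.foldl (fun σ g => g.apply inp σ) ρ

/-- The unnormalised state after a computational-basis measurement of the wires `w` has given
the outcome `u`; its trace is the probability of that outcome. -/
def postMeas {m : ℕ} (w : Fin m → ι) (u : Bits m) (ρ : Op ι) : Op ι := fun x y =>
  if (fun a => x (w a)) = u ∧ (fun a => y (w a)) = u then ρ x y else 0

/-- Density matrices. -/
def IsDensity (ρ : Op ι) : Prop := ρ.PosSemidef ∧ ρ.trace = 1

end Semantics

/-- The product state `ρ ⊗ σ`. -/
def tensor {ι κ : Type} (ρ : Op ι) (σ : Op κ) : Op (ι ⊕ κ) := fun x y =>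
  ρ (x ∘ Sum.inl) (y ∘ Sum.inl) * σ (x ∘ Sum.inr) (y ∘ Sum.inr)

/-! ### Non-uniform quantum polynomial time -/

/-- A non-uniform QPT algorithm with `c n` classical input bits, `q n` input qubits and `o n`
classical output bits: a family of polynomial-size circuits, acting on the input qubits and on
polynomially many work qubits that are initialised in an arbitrary auxiliary (advice) state. The
output is the outcome of measuring the wires `out`. -/
structure QPT (c q o : ℕ → ℕ) where
  work : ℕ → ℕ
  work_poly : PolyBounded work
  aux : ∀ n, Op (Fin (work n))
  aux_density : ∀ n, IsDensity (aux n)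
  circuit : ∀ n, Circuit (c n) (Fin (q n) ⊕ Fin (work n))
  size_poly : PolyBounded fun n => (circuit n).length
  out : ∀ n, Fin (o n) → Fin (q n) ⊕ Fin (work n)

/-- The probability that `A` outputs `v` on classical input `inp` and quantum input `ρ`
(for a subnormalised `ρ`, multiplied by the trace of `ρ`). -/
def QPT.prob {c q o : ℕ → ℕ} (A : QPT c q o) (n : ℕ) (inp : Bits (c n)) (ρ : Op (Fin (q n)))
    (v : Bits (o n)) : ℝ :=
  (postMeas (A.out n) v ((A.circuit n).run inp (tensor ρ (A.aux n)))).trace.re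

/-- The same for an algorithm without quantum input. -/
def QPT.probC {c o : ℕ → ℕ} (A : QPT c (fun _ => 0) o) (n : ℕ) (inp : Bits (c n))
    (v : Bits (o n)) : ℝ :=
  A.prob n inp 1 v

/-! ### Computational indistinguishability -/

/-- A classical-quantum state of `c` bits and `q` qubits: to every string it assigns the
subnormalised state of the qubits, whose trace is the probability of the string. -/
abbrev CQState (c q : ℕ) : Type := Bits c → Op (Fin q)

/-- The probability that the distinguisher `D` outputs `1` on a classical-quantum state. -/
def QPT.acceptProb {c q : ℕ → ℕ} (D : QPT c q fun _ => 1) (n : ℕ) (V : CQState (c n) (q n)) : ℝ :=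
  ∑ τ, D.prob n τ (V τ) fun _ => true

/-- Indistinguishability by non-uniform QPT distinguishers. -/
def QIndistinguishable {c q : ℕ → ℕ} (V W : ∀ n, CQState (c n) (q n)) : Prop :=
  ∀ D : QPT c q fun _ => 1,
    Negligible fun n => |D.acceptProb n (V n) - D.acceptProb n (W n)|

/-! ### Protocols over a classical channel between a classical Alice and a quantum Bob -/

/-- The honest, classical Alice of a protocol in which Alice and Bob alternately send two
messages each, Alice first. Alice has an input bit, uniformly random coins and an output bit; her
first message does not depend on her input. The lengths of the four messages are
`a₁`, `b₁`, `a₂`, `b₂`. -/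
structure ClassicalAlice where
  Coins : ℕ → Type
  [coinsFintype : ∀ n, Fintype (Coins n)]
  (a₁ b₁ a₂ b₂ : ℕ → ℕ)
  first : ∀ n, Coins n → Bits (a₁ n)
  second : ∀ n, Bool → Coins n → Bits (b₁ n) → Bits (a₂ n)
  output : ∀ n, Bool → Coins n → Bits (b₁ n) → Bits (b₂ n) → Bool

attribute [instance] ClassicalAlice.coinsFintype

/-- A malicious non-uniform QPT Bob: an internal quantum register in an arbitrary auxiliary
state, and one polynomial-size circuit for each of his two activations. After each activation
the wires that hold the outgoing message are measured. -/
structure MaliciousBob (P : ClassicalAlice) where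
  wires : ℕ → ℕ
  wires_poly : PolyBounded wires
  aux : ∀ n, Op (Fin (wires n))
  aux_density : ∀ n, IsDensity (aux n)
  act₁ : ∀ n, Circuit (P.a₁ n) (Fin (wires n))
  size₁_poly : PolyBounded fun n => (act₁ n).length
  send₁ : ∀ n, Fin (P.b₁ n) → Fin (wires n)
  act₂ : ∀ n, Circuit (P.a₁ n + P.a₂ n) (Fin (wires n))
  size₂_poly : PolyBounded fun n => (act₂ n).length
  send₂ : ∀ n, Fin (P.b₂ n) → Fin (wires n)

/-- Bob's unnormalised register at the end of a run in which Alice sends `α₁` and `α₂` and the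
messages measured on Bob's side are `u` and `v`. -/
def MaliciousBob.finalState {P : ClassicalAlice} (B : MaliciousBob P) (n : ℕ)
    (α₁ : Bits (P.a₁ n)) (u : Bits (P.b₁ n)) (α₂ : Bits (P.a₂ n)) (v : Bits (P.b₂ n)) :
    Op (Fin (B.wires n)) :=
  let ρ₁ := postMeas (B.send₁ n) u ((B.act₁ n).run α₁ (B.aux n))
  postMeas (B.send₂ n) v ((B.act₂ n).run (Fin.append α₁ α₂) ρ₁)

/-- The view of Bob in an execution with Alice on input `b`: the messages he has received,
together with his entire internal register at the end of the execution. -/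
def MaliciousBob.view {P : ClassicalAlice} (B : MaliciousBob P) (b : Bool) (n : ℕ) :
    CQState (P.a₁ n + P.a₂ n) (B.wires n) := fun τ =>
  (Fintype.card (P.Coins n) : ℂ)⁻¹ •
    ∑ r : P.Coins n, ∑ u : Bits (P.b₁ n), ∑ v : Bits (P.b₂ n),
      if Fin.append (P.first n r) (P.second n b r u) = τ then
        B.finalState n (P.first n r) u (P.second n b r u) v
      else 0

/-- Privacy of Alice's input against a malicious Bob. -/
def PrivateAgainstMaliciousBob (P : ClassicalAlice) : Prop :=
  ∀ B : MaliciousBob P, QIndistinguishable (B.view false) (B.view true)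

/-! ### The function family -/

/-- The syntax of a family of functions `f_k : {0,1}^domLen → {0,1}^rangeLen` with predicates
`h_k`. The key generator maps uniform coins to a key `k`, a trapdoor `t_k` and a bit `hp`; the
inversion algorithm maps a trapdoor, an image and coins to a pair of candidate preimages. -/
structure FunctionFamily where
  (keyLen trapLen domLen rangeLen genCoins invCoins : ℕ → ℕ)
  gen : ∀ n, Bits (genCoins n) → Bits (keyLen n) × Bits (trapLen n) × Bool
  f : ∀ n, Bits (keyLen n) → Bits (domLen n) → Bits (rangeLen n)
  h : ∀ n, Bits (keyLen n) → Bits (domLen n) → Bool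
  inv : ∀ n, Bits (trapLen n) → Bits (rangeLen n) → Bits (invCoins n) →
    Bits (domLen n) × Bits (domLen n)

namespace FunctionFamily

variable (F : FunctionFamily)

/-- The key produced from the coins `r`. -/
def key (n : ℕ) (r : Bits (F.genCoins n)) : Bits (F.keyLen n) := (F.gen n r).1

/-- The trapdoor produced from the coins `r`. -/
def trap (n : ℕ) (r : Bits (F.genCoins n)) : Bits (F.trapLen n) := (F.gen n r).2.1

/-- The bit `hp` produced from the coins `r`. -/
def hp (n : ℕ) (r : Bits (F.genCoins n)) : Bool := (F.gen n r).2.2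

/-- All lengths are polynomial, and `gen`, `f`, `h` and `inv` are polynomial-time algorithms. -/
structure Efficient : Prop where
  keyLen_poly : PolyBounded F.keyLen
  trapLen_poly : PolyBounded F.trapLen
  domLen_poly : PolyBounded F.domLen
  rangeLen_poly : PolyBounded F.rangeLen
  genCoins_poly : PolyBounded F.genCoins
  invCoins_poly : PolyBounded F.invCoins
  gen_polyTime : ∃ φ, PolyTime φ ∧ ∀ n r, φ (unary n ++ List.ofFn r) =
    List.ofFn (F.key n r) ++ List.ofFn (F.trap n r) ++ [F.hp n r]
  f_polyTime : ∃ φ, PolyTime φ ∧ ∀ n k x, φ (unary n ++ List.ofFn k ++ List.ofFn x) =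
    List.ofFn (F.f n k x)
  h_polyTime : ∃ φ, PolyTime φ ∧ ∀ n k x, φ (unary n ++ List.ofFn k ++ List.ofFn x) =
    [F.h n k x]
  inv_polyTime : ∃ φ, PolyTime φ ∧ ∀ n t y s,
    φ (unary n ++ List.ofFn t ++ List.ofFn y ++ List.ofFn s) =
      List.ofFn (F.inv n t y s).1 ++ List.ofFn (F.inv n t y s).2

/-- Two-regularity: with overwhelming probability over the key and a uniform `x`, the image
`f_k x` has exactly two preimages. (If every `f_k` is exactly two-regular, the probability of
failure is zero.) -/
def TwoRegular : Prop :=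
  Negligible fun n => uniformProb fun ω : Bits (F.genCoins n) × Bits (F.domLen n) =>
    Nat.card {x' // F.f n (F.key n ω.1) x' = F.f n (F.key n ω.1) ω.2} ≠ 2

/-- One-wayness: non-uniform QPT algorithms that are given `k` and `f_k x`, for a random key and
a uniform `x`, find a preimage of `f_k x` with negligible probability only. -/
def OneWay : Prop :=
  ∀ A : QPT (fun n => F.keyLen n + F.rangeLen n) (fun _ => 0) F.domLen,
    Negligible fun n => average fun ω : Bits (F.genCoins n) × Bits (F.domLen n) =>
      ∑ x' : Bits (F.domLen n),
        if F.f n (F.key n ω.1) x' = F.f n (F.key n ω.1) ω.2 then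
          A.probC n (Fin.append (F.key n ω.1) (F.f n (F.key n ω.1) ω.2)) x'
        else 0

/-- The trapdoor property: with overwhelming probability over the key and the trapdoor, a uniform
`x` and the coins of the inversion algorithm, inverting `f_k x` returns all its preimages. -/
def Invertible : Prop :=
  Negligible fun n => uniformProb
    fun ω : Bits (F.genCoins n) × Bits (F.domLen n) × Bits (F.invCoins n) =>
      let y := F.f n (F.key n ω.1) ω.2.1
      let p := F.inv n (F.trap n ω.1) y ω.2.2
      {x' | F.f n (F.key n ω.1) x' = y} ≠ {p.1, p.2}

/-- The predicates are homomorphic: up to negligible probability over the key and a uniform `x`,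
any two distinct preimages `x`, `x'` of the same image satisfy `h_k x ⊕ h_k x' = hp`. -/
def Homomorphic : Prop :=
  Negligible fun n => uniformProb fun ω : Bits (F.genCoins n) × Bits (F.domLen n) =>
    ∃ x', x' ≠ ω.2 ∧ F.f n (F.key n ω.1) x' = F.f n (F.key n ω.1) ω.2 ∧
      xor (F.h n (F.key n ω.1) ω.2) (F.h n (F.key n ω.1) x') ≠ F.hp n ω.1

/-- The bit `hp` is hardcore: given only the public key, a non-uniform QPT algorithm guesses it
with probability at most negligibly better than `1/2`. -/
def Hardcore : Prop :=
  ∀ A : QPT F.keyLen (fun _ => 0) fun _ => 1,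
    ∃ ε, Negligible ε ∧ ∀ n,
      (average fun r : Bits (F.genCoins n) => A.probC n (F.key n r) fun _ => F.hp n r)
        ≤ 1 / 2 + ε n

/-- A two-regular trapdoor one-way family. -/
structure IsTwoRegularTrapdoorOneWay : Prop where
  efficient : F.Efficient
  twoRegular : F.TwoRegular
  oneWay : F.OneWay
  invertible : F.Invertible

/-- The predicates `h_k` form a homomorphic hardcore predicate of the family. -/
structure IsHomomorphicHardcore : Prop where
  homomorphic : F.Homomorphic
  hardcore : F.Hardcore

/-! ### The protocol -/

/-- The angle `δ = b + θ₂ + 2 r_A mod 4`, in units of `π/2`. -/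
def angle (b θ₂ rA : Bool) : ZMod 4 :=
  (b.toNat + θ₂.toNat + 2 * rA.toNat : ℕ)

/-- The two binary digits of an angle. -/
def angleBits (δ : ZMod 4) : Bits 2 := fun i => δ.val.testBit i

/-- The inner product modulo two. -/
def innerBit {d : ℕ} (m x : Bits d) : Bool :=
  decide (Odd (Finset.univ.filter fun i => m i = true ∧ x i = true).card)

/-- Alice's output in the remote state preparation, for Bob's message `(y, m)`, where `x`, `x'`
are the preimages of `y` that the trapdoor gives:
`θ₁ = θ₂ · ⟨m, x ⊕ x'⟩ ⊕ h_k x · h_k x'`. -/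
def theta₁ (n : ℕ) (r : Bits (F.genCoins n)) (s : Bits (F.invCoins n))
    (y : Bits (F.rangeLen n)) (m : Bits (F.domLen n)) : Bool :=
  let p := F.inv n (F.trap n r) y s
  xor (F.hp n r && innerBit m fun i => xor (p.1 i) (p.2 i))
    (F.h n (F.key n r) p.1 && F.h n (F.key n r) p.2)

/-- Alice in the protocol `π_SH`. Her coins are those of the key generator, the bit `r_A`, and
those of the inversion algorithm.
* Alice runs the key generator and sends `k`; her basis bit is `θ₂ = hp`.
* Bob sends `m_qf = (y, m)`.
* Alice sends `δ = b + θ₂ + 2 r_A mod 4`.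
* Bob sends `(m₀, s̄)`.
* Alice outputs `s̄ ⊕ θ₁ ⊕ r_A ⊕ m₀ b`. -/
def piSH : ClassicalAlice where
  Coins n := Bits (F.genCoins n) × Bool × Bits (F.invCoins n)
  a₁ := F.keyLen
  b₁ n := F.rangeLen n + F.domLen n
  a₂ _ := 2
  b₂ _ := 2
  first n ω := F.key n ω.1
  second n b ω _ := angleBits (angle b (F.hp n ω.1) ω.2.1)
  output n b ω u v :=
    let y : Bits (F.rangeLen n) := fun i => u (Fin.castAdd _ i)
    let m : Bits (F.domLen n) := fun i => u (Fin.natAdd _ i)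
    xor (xor (xor (v 1) (F.theta₁ n ω.1 ω.2.2 y m)) ω.2.1) (v 0 && b)

end FunctionFamily

end OQFE

end

/-!
The angle `δ` hides Alice's input `b` because its parity is `b ⊕ hp`, while its other bit is masked
by the uniform coin `r_A`: for input `b` the angle is uniform among the two angles of parity
`b ⊕ hp` (`acceptProb_view_piSH`). Telling the two views apart therefore amounts to recognising
whether the parity of a random angle is `hp`, that is, to guessing the hardcore bit from the key.

The reduction runs Bob and then the distinguisher on an angle chosen by the reduction, which is
possible because the angle is all Bob learns after the key, and guesses that `hp` is the parity of
the angle if and only if the distinguisher accepts. Averaged over the four angles, the guess is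
correct with probability `1 / 2 + Δ / 2`, where `Δ` is the signed advantage of the distinguisher
(`sum_guessProb`), and the opposite guess with probability `1 / 2 - Δ / 2`. The reduction is
non-uniform, so it need not sample an angle: for every `n` the best angle and the best sign are
hardwired into its circuit. Hardness of `hp` then bounds `|Δ|` by twice a negligible function
(`abs_acceptProb_sub_le`).

The remaining work is to see that the reduction is one circuit of polynomial size
(`MaliciousBob.guesser`) with the claimed output probabilities (`MaliciousBob.probC_guesser`). The
sum over Bob's messages in the definition of his view becomes a measurement inside the circuit
(`run_measAll`), the angle becomes a hardwired input (`Circuit.run_hardwire`), and the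
distinguisher's work wires are untouched while Bob runs (`Circuit.run_map_inl`). The opposite guess
is the complementary event because circuits preserve the trace (`Circuit.trace_run`).
-/

namespace OQFE

/-! ### Polynomial bounds -/

theorem PolyBounded.mono {f g : ℕ → ℕ} (hg : PolyBounded g) (h : ∀ n, f n ≤ g n) :
    PolyBounded f :=
  let ⟨p, hp⟩ := hg
  ⟨p, fun n => (h n).trans (hp n)⟩

theorem PolyBounded.add {f g : ℕ → ℕ} (hf : PolyBounded f) (hg : PolyBounded g) :
    PolyBounded fun n => f n + g n := by
  obtain ⟨p, hp⟩ := hf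
  obtain ⟨q, hq⟩ := hg
  exact ⟨p + q, fun n => by simpa using add_le_add (hp n) (hq n)⟩

theorem PolyBounded.const (a : ℕ) : PolyBounded fun _ => a :=
  ⟨Polynomial.C a, fun n => by simp⟩

/-! ### Circuit transformations -/

section Transformations

variable {ι κ : Type} {c c' m : ℕ}

/-- The same operation on renamed wires. -/
def Gate.map (f : ι ↪ κ) : Gate c ι → Gate c κ
  | .x i => .x (f i)
  | .h i => .h (f i)
  | .t i => .t (f i)
  | .cnot i j hij => .cnot (f i) (f j) (f.injective.ne hij)
  | .read a i => .read a (f i)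
  | .meas i => .meas (f i)

/-- The operation with the last `c'` bits of the classical input hardwired to `β`: reading such a
bit becomes an `X` gate or disappears. -/
def Gate.hardwire (β : Bits c') : Gate (c + c') ι → Circuit c ι
  | .x i => [.x i]
  | .h i => [.h i]
  | .t i => [.t i]
  | .cnot i j hij => [.cnot i j hij]
  | .read a i =>
    Fin.addCases (fun a => [.read a i]) (fun a => if β a = true then [.x i] else []) a
  | .meas i => [.meas i]

theorem Gate.length_hardwire (β : Bits c') (g : Gate (c + c') ι) : (g.hardwire β).length ≤ 1 := by
  cases g with
  | read a i =>
    induction a using Fin.addCases with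
    | left a => simp [Gate.hardwire]
    | right a =>
      simp only [Gate.hardwire, Fin.addCases_right]
      split_ifs <;> simp
  | _ => exact le_rfl

/-- The circuit with the last `c'` bits of its classical input hardwired to `β`. -/
def Circuit.hardwire (β : Bits c') (C : Circuit (c + c') ι) : Circuit c ι :=
  C.flatMap (Gate.hardwire β)

theorem Circuit.length_hardwire (β : Bits c') (C : Circuit (c + c') ι) :
    (Circuit.hardwire β C).length ≤ C.length := by
  induction C with
  | nil => exact le_rfl
  | cons g C ih =>
    have := g.length_hardwire β
    simp only [Circuit.hardwire, List.flatMap_cons, List.length_append, List.length_cons] at ih ⊢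
    omega

/-- The circuit that measures the wires `w` one after the other. -/
def measAll (w : Fin m → ι) : Circuit c ι := (List.ofFn w).map Gate.meas

theorem length_measAll (w : Fin m → ι) : (measAll w : Circuit c ι).length = m := by
  simp [measAll]

/-- The state with the wires renamed along a bijection. -/
def relabel (e : ι ≃ κ) (ρ : Op ι) : Op κ := ρ.submatrix (· ∘ e) (· ∘ e)

theorem conjTranspose_tensor (A : Op ι) (B : Op κ) : (tensor A B)ᴴ = tensor Aᴴ Bᴴ := by
  ext x y
  simp [tensor]

theorem tensor_eq_kronecker (A : Op ι) (B : Op κ) :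
    tensor A B = (Matrix.kronecker A B).submatrix (Equiv.sumArrowEquivProdArrow ι κ Bool)
      (Equiv.sumArrowEquivProdArrow ι κ Bool) := rfl

theorem isLinearMap_tensor (σ : Op κ) : IsLinearMap ℂ fun ρ : Op ι => tensor ρ σ where
  map_add ρ ρ' := by ext x y; simp [tensor, add_mul]
  map_smul a ρ := by ext x y; simp [tensor, mul_assoc]

end Transformations

/-! ### Linearity of the circuit semantics -/

section Semantics

variable {ι κ : Type} [Fintype ι] [DecidableEq ι] [Fintype κ] [DecidableEq κ] {c c' m : ℕ}

theorem isLinearMap_conj (U : Op ι) : IsLinearMap ℂ (conj U) where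
  map_add ρ σ := by simp [conj, mul_add, add_mul]
  map_smul a ρ := by simp [conj]

theorem Gate.isLinearMap_apply (inp : Bits c) (g : Gate c ι) : IsLinearMap ℂ (g.apply inp) := by
  cases g with
  | read a i =>
    have hX := isLinearMap_conj (onWire pauliX i)
    constructor
    · intro ρ σ
      simp only [Gate.apply]
      split_ifs
      · exact hX.map_add ρ σ
      · rfl
    · intro b ρ
      simp only [Gate.apply]
      split_ifs
      · exact hX.map_smul b ρ
      · rfl
  | meas i =>
    constructor
    · intro ρ σ
      ext x y
      change (if x i = y i then ρ x y + σ x y else 0) =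
        (if x i = y i then ρ x y else 0) + if x i = y i then σ x y else 0
      split_ifs <;> simp
    · intro a ρ
      ext x y
      change (if x i = y i then a * ρ x y else 0) = a * if x i = y i then ρ x y else 0
      split_ifs <;> simp
  | _ => exact isLinearMap_conj _

theorem Circuit.run_append (C C' : Circuit c ι) (inp : Bits c) (ρ : Op ι) :
    Circuit.run (C ++ C') inp ρ = Circuit.run C' inp (Circuit.run C inp ρ) :=
  List.foldl_append

theorem Circuit.run_cons (g : Gate c ι) (C : Circuit c ι) (inp : Bits c) (ρ : Op ι) :
    Circuit.run (g :: C) inp ρ = Circuit.run C inp (g.apply inp ρ) := rfl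

theorem Circuit.isLinearMap_run (C : Circuit c ι) (inp : Bits c) :
    IsLinearMap ℂ (Circuit.run C inp) := by
  induction C with
  | nil => exact LinearMap.isLinear (LinearMap.id (R := ℂ) (M := Op ι))
  | cons g C ih =>
    have hg := g.isLinearMap_apply inp
    exact ⟨fun ρ σ => by simp [run_cons, hg.map_add, ih.map_add],
      fun a ρ => by simp [run_cons, hg.map_smul, ih.map_smul]⟩

theorem Circuit.run_sum {S : Type} (C : Circuit c ι) (inp : Bits c) (s : Finset S)
    (ρ : S → Op ι) :
    Circuit.run C inp (∑ a ∈ s, ρ a) = ∑ a ∈ s, Circuit.run C inp (ρ a) :=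
  map_sum ((C.isLinearMap_run inp).mk' _) ρ s

theorem isLinearMap_trace_postMeas (w : Fin m → ι) (u : Bits m) :
    IsLinearMap ℂ fun ρ : Op ι => (postMeas w u ρ).trace where
  map_add ρ σ := by
    rw [← Matrix.trace_add]
    congr 1
    ext x y
    simp only [postMeas, Matrix.add_apply]
    split_ifs <;> simp
  map_smul a ρ := by
    rw [← Matrix.trace_smul]
    congr 1
    ext x y
    simp only [postMeas, Matrix.smul_apply]
    split_ifs <;> simp

/-! ### Circuits preserve the trace -/

theorem onWire_mul (u v : Matrix Bool Bool ℂ) (i : ι) :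
    onWire u i * onWire v i = onWire (u * v) i := by
  ext x y
  rw [Matrix.mul_apply, onWire]
  -- Only the strings `z` that agree with `x` off the wire `i` contribute to the sum.
  have hsum : ∑ z, onWire u i x z * onWire v i z y =
      ∑ b, u (x i) b * onWire v i (Function.update x i b) y := by
    symm
    refine Fintype.sum_of_injective (Function.update x i) (Function.update_injective x i) _ _
      (fun z hz => ?_) (fun b => ?_)
    · rw [onWire, if_neg, zero_mul]
      intro h
      exact hz ⟨z i, by
        ext j
        by_cases hj : j = i
        · subst hj; simp
        · simp [hj, h j hj]⟩
    · have hx : onWire u i x (Function.update x i b) = u (x i) b := by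
        rw [onWire, if_pos fun j hj => by simp [hj], Function.update_self]
      rw [hx]
  rw [hsum]
  by_cases h : ∀ j, j ≠ i → x j = y j
  · rw [if_pos h, Matrix.mul_apply]
    refine Finset.sum_congr rfl fun b _ => ?_
    rw [onWire, if_pos]
    · simp
    · intro j hj
      simp [hj, h j hj]
  · rw [if_neg h]
    refine Finset.sum_eq_zero fun b _ => ?_
    rw [onWire, if_neg, mul_zero]
    intro h'
    exact h fun j hj => by simpa [hj] using h' j hj

theorem onWire_one (i : ι) : onWire (1 : Matrix Bool Bool ℂ) i = 1 := by
  ext x y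
  simp only [onWire, Matrix.one_apply]
  by_cases hxy : x = y
  · simp [hxy]
  · rw [if_neg hxy]
    split_ifs with h h'
    · exact absurd (funext fun j => if hj : j = i then hj ▸ h' else h j hj) hxy
    · rfl
    · rfl

theorem conjTranspose_onWire (u : Matrix Bool Bool ℂ) (i : ι) :
    (onWire u i)ᴴ = onWire uᴴ i := by
  ext x y
  simp only [Matrix.conjTranspose_apply, onWire, eq_comm]
  split_ifs <;> simp

theorem trace_conj {U : Op ι} (hU : Uᴴ * U = 1) (ρ : Op ι) : (conj U ρ).trace = ρ.trace := by
  rw [conj, Matrix.trace_mul_comm, ← Matrix.mul_assoc, hU, Matrix.one_mul]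

theorem trace_conj_onWire {u : Matrix Bool Bool ℂ} (hu : uᴴ * u = 1) (i : ι) (ρ : Op ι) :
    (conj (onWire u i) ρ).trace = ρ.trace :=
  trace_conj (by rw [conjTranspose_onWire, onWire_mul, hu, onWire_one]) ρ

theorem pauliX_isometry : pauliXᴴ * pauliX = 1 := by
  ext a b
  cases a <;> cases b <;> simp [Matrix.mul_apply, pauliX]

theorem hadamard_isometry : hadamardᴴ * hadamard = 1 := by
  have h : ((Real.sqrt 2 : ℂ)⁻¹) * (Real.sqrt 2 : ℂ)⁻¹ = 1 / 2 := by
    rw [← mul_inv, ← Complex.ofReal_mul, Real.mul_self_sqrt (by norm_num)]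
    norm_num
  ext a b
  cases a <;> cases b <;> norm_num [Matrix.mul_apply, hadamard, h]

theorem tGate_isometry : tGateᴴ * tGate = 1 := by
  ext a b
  cases a <;> cases b <;> simp [Matrix.mul_apply, tGate]
  rw [← Complex.exp_conj, ← Complex.exp_add]
  simp [Complex.conj_I]
  rw [show (starRingEnd ℂ) 4 = 4 from Complex.conj_ofNat 4]
  ring_nf
  simp

theorem cnotOp_isometry {i j : ι} (hij : i ≠ j) : (cnotOp i j)ᴴ * cnotOp i j = 1 := by
  have hinv : Function.Involutive
      fun y : ι → Bool => Function.update y j (xor (y j) (y i)) := by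
    intro y
    simp [Function.update_of_ne hij]
  ext x y
  simp only [Matrix.mul_apply, Matrix.conjTranspose_apply, cnotOp, Matrix.one_apply]
  simp [hinv.injective.eq_iff, eq_comm]

theorem Gate.trace_apply (inp : Bits c) (g : Gate c ι) (ρ : Op ι) :
    (g.apply inp ρ).trace = ρ.trace := by
  cases g with
  | x i => exact trace_conj_onWire pauliX_isometry i ρ
  | h i => exact trace_conj_onWire hadamard_isometry i ρ
  | t i => exact trace_conj_onWire tGate_isometry i ρ
  | cnot i j hij => exact trace_conj (cnotOp_isometry hij) ρ
  | read a i =>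
    rw [Gate.apply]
    split_ifs
    · exact trace_conj_onWire pauliX_isometry i ρ
    · rfl
  | meas i =>
    change ∑ x, (if x i = x i then ρ x x else 0) = ∑ x, ρ x x
    simp

theorem Circuit.trace_run (C : Circuit c ι) (inp : Bits c) (ρ : Op ι) :
    (Circuit.run C inp ρ).trace = ρ.trace := by
  induction C generalizing ρ with
  | nil => rfl
  | cons g C ih => rw [run_cons, ih, g.trace_apply]

theorem sum_trace_postMeas (w : Fin m → ι) (ρ : Op ι) :
    ∑ u, (postMeas w u ρ).trace = ρ.trace := by
  simp only [Matrix.trace, Matrix.diag, postMeas, and_self]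
  rw [Finset.sum_comm]
  simp

/-! ### Adding wires and renaming wires -/

theorem tensor_mul (A B : Op ι) (A' B' : Op κ) :
    tensor A A' * tensor B B' = tensor (A * B) (A' * B') := by
  ext x y
  simp only [Matrix.mul_apply, tensor, Finset.sum_mul_sum]
  rw [← Fintype.sum_prod_type',
    ← (Equiv.sumArrowEquivProdArrow ι κ Bool).sum_comp]
  refine Finset.sum_congr rfl fun z _ => ?_
  simp only [Equiv.sumArrowEquivProdArrow, Equiv.coe_fn_mk]
  ring

theorem trace_tensor (A : Op ι) (B : Op κ) : (tensor A B).trace = A.trace * B.trace := by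
  rw [← Matrix.trace_kronecker, tensor_eq_kronecker]
  exact (Equiv.sumArrowEquivProdArrow ι κ Bool).sum_comp fun p => Matrix.kronecker A B p p

theorem IsDensity.tensor {A : Op ι} {B : Op κ} (hA : IsDensity A) (hB : IsDensity B) :
    IsDensity (tensor A B) :=
  ⟨tensor_eq_kronecker A B ▸ (hA.1.kronecker hB.1).submatrix _,
    by rw [trace_tensor, hA.2, hB.2, one_mul]⟩

theorem conj_tensor (U ρ : Op ι) (σ : Op κ) :
    conj (tensor U 1) (tensor ρ σ) = tensor (conj U ρ) σ := by
  simp [conj, conjTranspose_tensor, tensor_mul]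

theorem relabel_mul (e : ι ≃ κ) (A B : Op ι) :
    relabel e A * relabel e B = relabel e (A * B) :=
  Matrix.submatrix_mul_equiv A B _ (e.symm.arrowCongr (Equiv.refl Bool)) _

theorem conj_relabel (e : ι ≃ κ) (U ρ : Op ι) :
    conj (relabel e U) (relabel e ρ) = relabel e (conj U ρ) := by
  rw [conj, conj, show (relabel e U)ᴴ = relabel e Uᴴ from rfl, relabel_mul, relabel_mul]

theorem trace_relabel (e : ι ≃ κ) (ρ : Op ι) : (relabel e ρ).trace = ρ.trace :=
  (e.symm.arrowCongr (Equiv.refl Bool)).sum_comp fun x => ρ x x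

theorem IsDensity.relabel {ρ : Op ι} (hρ : IsDensity ρ) (e : ι ≃ κ) :
    IsDensity (relabel e ρ) :=
  ⟨hρ.1.submatrix _, by rw [trace_relabel, hρ.2]⟩

theorem onWire_inl (u : Matrix Bool Bool ℂ) (i : ι) :
    onWire u (Sum.inl i : ι ⊕ κ) = tensor (onWire u i) 1 := by
  ext x y
  have h : (∀ j : ι ⊕ κ, j ≠ Sum.inl i → x j = y j) ↔
      (∀ j, j ≠ i → x (.inl j) = y (.inl j)) ∧ x ∘ Sum.inr = y ∘ Sum.inr := by
    simp [Sum.forall, funext_iff]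
  simp only [onWire, tensor, h, Matrix.one_apply, Function.comp_apply]
  split_ifs <;> simp_all

theorem cnotOp_inl (i j : ι) :
    cnotOp (Sum.inl i : ι ⊕ κ) (Sum.inl j) = tensor (cnotOp i j) 1 := by
  ext x y
  have h : x = Function.update y (Sum.inl j) (xor (y (.inl j)) (y (.inl i))) ↔
      x ∘ Sum.inl = Function.update (y ∘ Sum.inl) j (xor (y (.inl j)) (y (.inl i))) ∧
        x ∘ Sum.inr = y ∘ Sum.inr := by
    simp [funext_iff, Sum.forall, Function.update_apply]
  simp only [cnotOp, tensor, h, Matrix.one_apply, Function.comp_apply]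
  split_ifs <;> simp_all

theorem Gate.apply_map_inl (inp : Bits c) (g : Gate c ι) (ρ : Op ι) (σ : Op κ) :
    (g.map Function.Embedding.inl).apply inp (tensor ρ σ) = tensor (g.apply inp ρ) σ := by
  cases g with
  | cnot i j hij =>
    simp only [Gate.map, Gate.apply, Function.Embedding.inl_apply, cnotOp_inl, conj_tensor]
  | meas i =>
    ext x y
    simp only [Gate.map, Gate.apply, tensor, Function.Embedding.inl_apply, Function.comp_apply]
    split_ifs <;> simp
  | read a i =>
    simp only [Gate.map, Gate.apply, Function.Embedding.inl_apply, onWire_inl, conj_tensor]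
    split_ifs <;> rfl
  | _ => simp only [Gate.map, Gate.apply, Function.Embedding.inl_apply, onWire_inl, conj_tensor]

/-- A circuit that touches only some of the wires leaves an independent state on the others
unchanged. -/
theorem Circuit.run_map_inl (C : Circuit c ι) (inp : Bits c) (ρ : Op ι) (σ : Op κ) :
    Circuit.run (C.map (Gate.map Function.Embedding.inl)) inp (tensor ρ σ) =
      tensor (Circuit.run C inp ρ) σ := by
  induction C generalizing ρ with
  | nil => rfl
  | cons g C ih => rw [List.map_cons, run_cons, g.apply_map_inl, ih, run_cons]

theorem onWire_relabel (e : ι ≃ κ) (u : Matrix Bool Bool ℂ) (i : ι) :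
    onWire u (e i) = relabel e (onWire u i) := by
  ext x y
  simp [relabel, onWire, ← e.forall_congr_right (q := fun j => j ≠ e i → x j = y j)]

theorem cnotOp_relabel (e : ι ≃ κ) (i j : ι) :
    cnotOp (e i) (e j) = relabel e (cnotOp i j) := by
  ext x y
  simp [relabel, cnotOp, funext_iff, Function.update_apply,
    ← e.forall_congr_right (q := fun a => x a = if a = e j then _ else y a)]

theorem Gate.apply_map_equiv (e : ι ≃ κ) (inp : Bits c) (g : Gate c ι) (ρ : Op ι) :
    (g.map e.toEmbedding).apply inp (relabel e ρ) = relabel e (g.apply inp ρ) := by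
  cases g with
  | cnot i j hij =>
    simp only [Gate.map, Gate.apply, Equiv.coe_toEmbedding, cnotOp_relabel, conj_relabel]
  | meas i => rfl
  | read a i =>
    simp only [Gate.map, Gate.apply, Equiv.coe_toEmbedding, onWire_relabel, conj_relabel]
    split_ifs <;> rfl
  | _ => simp only [Gate.map, Gate.apply, Equiv.coe_toEmbedding, onWire_relabel, conj_relabel]

theorem Circuit.run_map_equiv (e : ι ≃ κ) (C : Circuit c ι) (inp : Bits c) (ρ : Op ι) :
    Circuit.run (C.map (Gate.map e.toEmbedding)) inp (relabel e ρ) =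
      relabel e (Circuit.run C inp ρ) := by
  induction C generalizing ρ with
  | nil => rfl
  | cons g C ih => rw [List.map_cons, run_cons, g.apply_map_equiv, ih, run_cons]

theorem trace_postMeas_relabel (e : ι ≃ κ) (w : Fin m → ι) (u : Bits m) (ρ : Op ι) :
    (postMeas (fun a => e (w a)) u (relabel e ρ)).trace = (postMeas w u ρ).trace :=
  trace_relabel e (postMeas w u ρ)

/-! ### Hardwired inputs and measured messages -/

theorem Gate.run_hardwire (α : Bits c) (β : Bits c') (g : Gate (c + c') ι) (ρ : Op ι) :
    Circuit.run (g.hardwire β) α ρ = g.apply (Fin.append α β) ρ := by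
  cases g with
  | read a i =>
    induction a using Fin.addCases with
    | left a => simp [Gate.hardwire, Circuit.run, Gate.apply]
    | right a =>
      simp only [Gate.hardwire, Fin.addCases_right, Gate.apply, Fin.append_right]
      split_ifs <;> rfl
  | _ => rfl

theorem Circuit.run_hardwire (α : Bits c) (β : Bits c') (C : Circuit (c + c') ι) (ρ : Op ι) :
    Circuit.run (Circuit.hardwire β C) α ρ = Circuit.run C (Fin.append α β) ρ := by
  induction C generalizing ρ with
  | nil => rfl
  | cons g C ih =>
    simp only [Circuit.hardwire, List.flatMap_cons] at ih ⊢
    rw [run_append, g.run_hardwire, ih, run_cons]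

/-- Measuring wires within the circuit has the same effect as splitting the run according to the
outcome and adding up the unnormalised states of all outcomes. -/
theorem run_measAll (inp : Bits c) (w : Fin m → ι) (ρ : Op ι) :
    Circuit.run (measAll w) inp ρ = ∑ u, postMeas w u ρ := by
  have hlist : ∀ (l : List ι) (ρ : Op ι) (x y : ι → Bool),
      Circuit.run (l.map Gate.meas) inp ρ x y = if ∀ i ∈ l, x i = y i then ρ x y else 0 := by
    intro l
    induction l with
    | nil => intro ρ x y; simp [Circuit.run]
    | cons i l ih =>
      intro ρ x y
      rw [List.map_cons, Circuit.run_cons, ih]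
      simp only [Gate.apply, List.forall_mem_cons]
      split_ifs <;> simp_all
  ext x y
  rw [measAll, hlist, Matrix.sum_apply]
  simp only [postMeas, List.forall_mem_ofFn_iff, ite_and, Finset.sum_ite_eq, Finset.mem_univ,
    if_true]
  simp only [funext_iff, eq_comm]

theorem conj_pauliX (i : ι) (ρ : Op ι) (x y : ι → Bool) :
    conj (onWire pauliX i) ρ x y =
      ρ (Function.update x i (!x i)) (Function.update y i (!y i)) := by
  have hX : ∀ x y : ι → Bool,
      onWire pauliX i x y = if y = Function.update x i (!x i) then 1 else 0 := by
    intro x y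
    have h : y = Function.update x i (!x i) ↔ (∀ j, j ≠ i → x j = y j) ∧ x i ≠ y i := by
      constructor
      · rintro rfl
        simp +contextual
      · rintro ⟨h, hi⟩
        ext j
        by_cases hj : j = i
        · subst hj
          simpa using (Bool.eq_not.mpr hi.symm)
        · simp [hj, h j hj]
    by_cases hoff : ∀ j, j ≠ i → x j = y j
    · by_cases hi : x i = y i
      · rw [if_neg fun hy => (h.mp hy).2 hi, onWire, if_pos hoff, pauliX, if_pos hi]
      · rw [if_pos (h.mpr ⟨hoff, hi⟩), onWire, if_pos hoff, pauliX, if_neg hi]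
    · rw [if_neg fun hy => hoff (h.mp hy).1, onWire, if_neg hoff]
  simp [conj, Matrix.mul_apply, hX]

/-- Flipping the output wire before it is measured flips the outcome. -/
theorem trace_postMeas_conj_pauliX (w : Fin 1 → ι) (v : Bool) (ρ : Op ι) :
    (postMeas w (fun _ => v) (conj (onWire pauliX (w 0)) ρ)).trace =
      (postMeas w (fun _ => !v) ρ).trace := by
  have hinv : Function.Involutive
      fun x : ι → Bool => Function.update x (w 0) (!x (w 0)) := fun x => by simp
  simp only [Matrix.trace, Matrix.diag, postMeas, and_self, conj_pauliX]
  refine Fintype.sum_equiv hinv.toPerm _ _ fun x => ?_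
  simp [funext_iff]

end Semantics

/-! ### Output probabilities of algorithms -/

namespace QPT

variable {c q o : ℕ → ℕ} (A : QPT c q o) (n : ℕ) (inp : Bits (c n))

theorem isLinearMap_trace (v : Bits (o n)) : IsLinearMap ℂ fun ρ : Op (Fin (q n)) =>
    (postMeas (A.out n) v ((A.circuit n).run inp (tensor ρ (A.aux n)))).trace :=
  have hP := isLinearMap_trace_postMeas (A.out n) v
  have hR := Circuit.isLinearMap_run (A.circuit n) inp
  have hT := isLinearMap_tensor (ι := Fin (q n)) (A.aux n)
  ⟨fun ρ σ => by rw [hT.map_add, hR.map_add, hP.map_add],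
    fun a ρ => by rw [hT.map_smul, hR.map_smul, hP.map_smul]⟩

theorem prob_sum {S : Type} (s : Finset S) (ρ : S → Op (Fin (q n))) (v : Bits (o n)) :
    A.prob n inp (∑ a ∈ s, ρ a) v = ∑ a ∈ s, A.prob n inp (ρ a) v := by
  simp only [prob, ← Complex.re_sum]
  exact congrArg Complex.re (map_sum ((A.isLinearMap_trace n inp v).mk' _) ρ s)

theorem prob_smul (a : ℝ) (ρ : Op (Fin (q n))) (v : Bits (o n)) :
    A.prob n inp ((a : ℂ) • ρ) v = a * A.prob n inp ρ v := by
  simp only [prob]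
  rw [(A.isLinearMap_trace n inp v).map_smul]
  simp

theorem prob_zero (v : Bits (o n)) : A.prob n inp 0 v = 0 := by
  simpa using A.prob_smul n inp 0 0 v

theorem sum_prob (ρ : Op (Fin (q n))) : ∑ v, A.prob n inp ρ v = ρ.trace.re := by
  simp only [prob]
  rw [← Complex.re_sum, sum_trace_postMeas, Circuit.trace_run, trace_tensor,
    (A.aux_density n).2, mul_one]

end QPT

/-! ### Simulating Bob and the distinguisher -/

namespace MaliciousBob

variable {P : ClassicalAlice} (B : MaliciousBob P)

/-- Bob's two activations as one circuit, with Alice's second message hardwired to `δ`. -/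
def circuit (n : ℕ) (δ : Bits (P.a₂ n)) : Circuit (P.a₁ n) (Fin (B.wires n)) :=
  B.act₁ n ++ measAll (B.send₁ n) ++ Circuit.hardwire δ (B.act₂ n) ++ measAll (B.send₂ n)

/-- Bob's register at the end of a run in which Alice sends `α` and `δ`, irrespective of what
Bob sends. -/
noncomputable def register (n : ℕ) (α : Bits (P.a₁ n)) (δ : Bits (P.a₂ n)) : Op (Fin (B.wires n)) :=
  ∑ u, ∑ v, B.finalState n α u δ v

theorem run_circuit (n : ℕ) (α : Bits (P.a₁ n)) (δ : Bits (P.a₂ n)) :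
    Circuit.run (B.circuit n δ) α (B.aux n) = B.register n α δ := by
  simp only [circuit, Circuit.run_append, run_measAll, Circuit.run_hardwire, Circuit.run_sum]
  rfl

theorem trace_register (n : ℕ) (α : Bits (P.a₁ n)) (δ : Bits (P.a₂ n)) :
    (B.register n α δ).trace = 1 := by
  rw [← run_circuit, Circuit.trace_run, (B.aux_density n).2]

theorem length_circuit_le (n : ℕ) (δ : Bits (P.a₂ n)) : (B.circuit n δ).length ≤
    (B.act₁ n).length + P.b₁ n + (B.act₂ n).length + P.b₂ n := by
  have := Circuit.length_hardwire δ (B.act₂ n)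
  simp only [circuit, List.length_append, length_measAll]
  omega

variable (D : QPT (fun n => P.a₁ n + P.a₂ n) B.wires fun _ => 1)

/-- The probability that `D` outputs `w` on Bob's view if Alice sends `α` and `δ`. -/
noncomputable def outProb (n : ℕ) (α : Bits (P.a₁ n)) (δ : Bits (P.a₂ n)) (w : Bool) : ℝ :=
  D.prob n (Fin.append α δ) (B.register n α δ) fun _ => w

theorem outProb_true_add_false (n : ℕ) (α : Bits (P.a₁ n)) (δ : Bits (P.a₂ n)) :
    B.outProb D n α δ true + B.outProb D n α δ false = 1 := by
  have h := D.sum_prob n (Fin.append α δ) (B.register n α δ)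
  rw [B.trace_register, Complex.one_re,
    ← (Equiv.funUnique (Fin 1) Bool).symm.sum_comp, Fintype.sum_bool] at h
  exact h

/-- If Alice's second message does not depend on Bob's, then a distinguisher accepts Bob's view
with the average probability, over Alice's coins, of accepting for her two messages. -/
theorem acceptProb_view (b : Bool) (n : ℕ) (second : P.Coins n → Bits (P.a₂ n))
    (hsecond : ∀ r u, P.second n b r u = second r) :
    D.acceptProb n (B.view b n) =
      average fun r => B.outProb D n (P.first n r) (second r) true := by
  have hview : ∀ τ, B.view b n τ = (((Fintype.card (P.Coins n) : ℝ)⁻¹ : ℝ) : ℂ) •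
      ∑ r, if Fin.append (P.first n r) (second r) = τ then
        B.register n (P.first n r) (second r) else 0 := by
    intro τ
    simp only [view, hsecond, register]
    rw [Complex.ofReal_inv, Complex.ofReal_natCast]
    congr 1
    refine Finset.sum_congr rfl fun r _ => ?_
    split_ifs <;> simp
  simp only [QPT.acceptProb, hview, QPT.prob_smul, QPT.prob_sum, average, ← Finset.mul_sum]
  rw [Finset.sum_comm]
  congr 1
  refine Finset.sum_congr rfl fun r _ => ?_
  rw [Finset.sum_eq_single (Fin.append (P.first n r) (second r))]
  · simp [outProb]
  · intro τ _ hτ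
    rw [if_neg hτ.symm, QPT.prob_zero]
  · simp

/-- The wires of Bob and of the distinguisher as the wires of an algorithm without quantum
input. -/
def wireEquiv (n : ℕ) : Fin (B.wires n) ⊕ Fin (D.work n) ≃ Fin 0 ⊕ Fin (B.wires n + D.work n) :=
  finSumFinEquiv.trans (Equiv.emptySum (Fin 0) _).symm

/-- Bob's circuit followed by the distinguisher's, with Alice's second message hardwired to `δ`,
and with the distinguisher's output bit flipped if `s` is one. -/
def guessCircuit (n : ℕ) (δ : Bits (P.a₂ n)) (s : Bool) :
    Circuit (P.a₁ n) (Fin (B.wires n) ⊕ Fin (D.work n)) :=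
  (B.circuit n δ).map (Gate.map Function.Embedding.inl) ++ Circuit.hardwire δ (D.circuit n) ++
    if s = true then [Gate.x (D.out n 0)] else []

/-- The algorithm that, given only Alice's first message, runs Bob and the distinguisher on the
hardwired second message `δ n` and outputs the distinguisher's bit, flipped if `s n` is one. -/
def guesser (hb₁ : PolyBounded P.b₁) (hb₂ : PolyBounded P.b₂) (δ : ∀ n, Bits (P.a₂ n))
    (s : ℕ → Bool) : QPT P.a₁ (fun _ => 0) fun _ => 1 where
  work n := B.wires n + D.work n
  work_poly := B.wires_poly.add D.work_poly
  aux n := relabel finSumFinEquiv (tensor (B.aux n) (D.aux n))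
  aux_density n := ((B.aux_density n).tensor (D.aux_density n)).relabel _
  circuit n := (B.guessCircuit D n (δ n) (s n)).map (Gate.map (B.wireEquiv D n).toEmbedding)
  size_poly := by
    refine PolyBounded.mono (((((B.size₁_poly.add hb₁).add B.size₂_poly).add hb₂).add
      D.size_poly).add (PolyBounded.const 1)) fun n => ?_
    have h₁ := B.length_circuit_le n (δ n)
    have h₂ := Circuit.length_hardwire (δ n) (D.circuit n)
    have h₃ : (if s n = true then [Gate.x (D.out n 0)] else [] :
        Circuit (P.a₁ n) (Fin (B.wires n) ⊕ Fin (D.work n))).length ≤ 1 := by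
      split_ifs <;> simp
    simp only [guessCircuit, List.length_map, List.length_append]
    omega
  out n a := B.wireEquiv D n (D.out n a)

theorem probC_guesser (hb₁ : PolyBounded P.b₁) (hb₂ : PolyBounded P.b₂)
    (δ : ∀ n, Bits (P.a₂ n)) (s : ℕ → Bool) (n : ℕ) (α : Bits (P.a₁ n)) (w : Bool) :
    ((B.guesser D hb₁ hb₂ δ s).probC n α fun _ => w) =
      B.outProb D n α (δ n) (xor w (s n)) := by
  have haux : tensor (1 : Op (Fin 0)) ((B.guesser D hb₁ hb₂ δ s).aux n) =
      relabel (B.wireEquiv D n) (tensor (B.aux n) (D.aux n)) := by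
    ext x y
    have hone : (1 : Op (Fin 0)) (x ∘ Sum.inl) (y ∘ Sum.inl) = 1 := by
      rw [Subsingleton.elim (x ∘ Sum.inl) (y ∘ Sum.inl), Matrix.one_apply_eq]
    exact (congrArg (· * _) hone).trans (one_mul _)
  have hrun : (postMeas ((B.guesser D hb₁ hb₂ δ s).out n) (fun _ => w)
      (((B.guesser D hb₁ hb₂ δ s).circuit n).run α
        (tensor 1 ((B.guesser D hb₁ hb₂ δ s).aux n)))).trace =
      (postMeas (D.out n) (fun _ => xor w (s n))
        ((D.circuit n).run (Fin.append α (δ n))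
          (tensor (B.register n α (δ n)) (D.aux n)))).trace := by
    rw [haux]
    change (postMeas (fun a => B.wireEquiv D n (D.out n a)) _ (Circuit.run
      ((B.guessCircuit D n (δ n) (s n)).map (Gate.map (B.wireEquiv D n).toEmbedding))
      _ _)).trace = _
    rw [Circuit.run_map_equiv, trace_postMeas_relabel, guessCircuit, Circuit.run_append,
      Circuit.run_append, Circuit.run_map_inl, run_circuit, Circuit.run_hardwire]
    cases s n with
    | false => simp [Circuit.run]
    | true =>
      rw [Bool.xor_true]
      exact trace_postMeas_conj_pauliX _ _ _
  exact congrArg Complex.re hrun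

end MaliciousBob

/-! ### Averages over Alice's coins -/

theorem average_add {Ω : Type} [Fintype Ω] (g g' : Ω → ℝ) :
    (average fun ω => g ω + g' ω) = average g + average g' := by
  simp [average, Finset.sum_add_distrib, mul_add]

theorem average_const_mul {Ω : Type} [Fintype Ω] (a : ℝ) (g : Ω → ℝ) :
    (average fun ω => a * g ω) = a * average g := by
  simp only [average, ← Finset.mul_sum]
  ring

theorem average_sub {Ω : Type} [Fintype Ω] (g g' : Ω → ℝ) :
    (average fun ω => g ω - g' ω) = average g - average g' := by
  simp [average, Finset.sum_sub_distrib, mul_sub]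

theorem average_const {Ω : Type} [Fintype Ω] [Nonempty Ω] (a : ℝ) :
    (average fun _ : Ω => a) = a := by
  simp [average]

/-- Coins on which the averaged quantity does not depend can be dropped, and a coin flip can be
averaged out. -/
theorem average_coins {Ω Ω' : Type} [Fintype Ω] [Fintype Ω'] [Nonempty Ω'] (g : Ω → Bool → ℝ) :
    (average fun ω : Ω × Bool × Ω' => g ω.1 ω.2.1) =
      average fun ω => (g ω true + g ω false) / 2 := by
  have h : (Fintype.card Ω' : ℝ) ≠ 0 := by simp
  simp only [average, Fintype.sum_prod_type, Finset.sum_const, Fintype.card_prod,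
    Fintype.card_bool, Fintype.sum_bool, Finset.card_univ, nsmul_eq_mul, Nat.cast_mul,
    ← Finset.mul_sum, ← Finset.sum_div]
  field_simp
  push_cast
  ring

namespace FunctionFamily

variable (F : FunctionFamily)

/-- The angles with parity `β`, indexed by a bit `ρ`. -/
def angleOfParity (β ρ : Bool) : Bits 2 := angleBits (angle false β ρ)

theorem angleBits_angle_true (θ ρ : Bool) :
    angleBits (angle true θ ρ) = angleOfParity (!θ) (xor ρ θ) := by
  revert θ ρ
  decide

/-- The probability that flipping the distinguisher's output by `s`, when Alice's second message
is `δ`, yields the hardcore bit. -/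
noncomputable def guessProb (B : MaliciousBob F.piSH)
    (D : QPT (fun n => F.piSH.a₁ n + F.piSH.a₂ n) B.wires fun _ => 1)
    (n : ℕ) (δ : Bits 2) (s : Bool) : ℝ :=
  average fun r : Bits (F.genCoins n) =>
    B.outProb D n (F.key n r) δ (xor (F.hp n r) s)

variable {F} (B : MaliciousBob F.piSH)
  (D : QPT (fun n => F.piSH.a₁ n + F.piSH.a₂ n) B.wires fun _ => 1)

/-- Alice's second message has parity `hp` for input zero and `¬ hp` for input one. -/
theorem acceptProb_view_piSH (b : Bool) (n : ℕ) :
    D.acceptProb n (B.view b n) = average fun r : Bits (F.genCoins n) =>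
      (B.outProb D n (F.key n r) (angleOfParity (xor b (F.hp n r)) true) true +
        B.outProb D n (F.key n r) (angleOfParity (xor b (F.hp n r)) false) true) / 2 := by
  rw [B.acceptProb_view D b n (fun ω => angleBits (angle b (F.hp n ω.1) ω.2.1))
    (fun _ _ => rfl)]
  refine (average_coins (Ω' := Bits (F.invCoins n)) fun (r : Bits (F.genCoins n)) ρ =>
    B.outProb D n (F.key n r) (angleBits (angle b (F.hp n r) ρ)) true).trans ?_
  congr 1
  ext r
  cases b with
  | false => simp [angleOfParity]
  | true =>
    simp only [angleBits_angle_true, Bool.true_xor]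
    cases F.hp n r
    · rfl
    · simp [add_comm]

theorem guessProb_not (n : ℕ) (δ : Bits 2) (s : Bool) :
    F.guessProb B D n δ s + F.guessProb B D n δ (!s) = 1 := by
  rw [guessProb, guessProb, ← average_add]
  refine Eq.trans (congrArg average (funext fun r => ?_)) (average_const 1)
  have h := B.outProb_true_add_false D n (F.key n r) δ
  cases F.hp n r <;> cases s <;> simp [← h, add_comm]

/-- The advantage of the distinguisher is the average advantage, over the four angles, of the
guess "`hp` is the parity of the angle if and only if the distinguisher accepts". -/
theorem sum_guessProb (n : ℕ) :
    ∑ β, ∑ ρ, F.guessProb B D n (angleOfParity β ρ) (!β) =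
      2 + 2 * (D.acceptProb n (B.view false n) - D.acceptProb n (B.view true n)) := by
  have htwo : (2 : ℝ) = average fun _ : Bits (F.genCoins n) => 2 := (average_const 2).symm
  rw [acceptProb_view_piSH, acceptProb_view_piSH, ← average_sub, ← average_const_mul]
  nth_rw 1 [htwo]
  rw [← average_add]
  simp only [Fintype.sum_bool, guessProb, ← average_add]
  congr 1
  ext r
  have h := fun δ => B.outProb_true_add_false D n (F.key n r) δ
  have h₁ := h (angleOfParity (!F.hp n r) true)
  have h₂ := h (angleOfParity (!F.hp n r) false)
  cases hr : F.hp n r <;> simp [hr] at h₁ h₂ ⊢ <;> linarith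

/-- If every guess of the hardcore bit succeeds with probability at most `1 / 2 + ε`, then the
advantage of the distinguisher is at most `2 * ε`. -/
theorem abs_acceptProb_sub_le (n : ℕ) (ε : ℝ)
    (h : ∀ δ s, F.guessProb B D n δ s ≤ 1 / 2 + ε) :
    |D.acceptProb n (B.view false n) - D.acceptProb n (B.view true n)| ≤ 2 * ε := by
  have hsum := sum_guessProb B D n
  simp only [Fintype.sum_bool] at hsum
  have hbound : ∀ β ρ, 1 / 2 - ε ≤ F.guessProb B D n (angleOfParity β ρ) (!β) ∧
      F.guessProb B D n (angleOfParity β ρ) (!β) ≤ 1 / 2 + ε := fun β ρ => by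
    have h₁ := guessProb_not B D n (angleOfParity β ρ) (!β)
    have h₂ := h (angleOfParity β ρ) (!!β)
    exact ⟨by linarith, h _ _⟩
  have htt := hbound true true
  have htf := hbound true false
  have hft := hbound false true
  have hff := hbound false false
  rw [abs_le]
  constructor <;> linarith [htt.1, htt.2, htf.1, htf.2, hft.1, hft.2, hff.1, hff.2]

end FunctionFamily

end OQFE

theorem mainTheorem8 (F : OQFE.FunctionFamily) (hF : F.IsTwoRegularTrapdoorOneWay)
    (hh : F.IsHomomorphicHardcore) : OQFE.PrivateAgainstMaliciousBob F.piSH := by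
  intro B D
  -- The best angle and flip for each `n` are hardwired into a single non-uniform algorithm.
  have hmax : ∀ n, ∃ p : OQFE.Bits 2 × Bool, ∀ δ s,
      F.guessProb B D n δ s ≤ F.guessProb B D n p.1 p.2 := fun n =>
    let ⟨p, hp⟩ := Finite.exists_max fun p : OQFE.Bits 2 × Bool => F.guessProb B D n p.1 p.2
    ⟨p, fun δ s => hp (δ, s)⟩
  choose p hp using hmax
  have hb₁ : OQFE.PolyBounded F.piSH.b₁ := hF.efficient.rangeLen_poly.add hF.efficient.domLen_poly
  have hb₂ : OQFE.PolyBounded F.piSH.b₂ := OQFE.PolyBounded.const 2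
  obtain ⟨ε, hε, hguess⟩ :=
    hh.hardcore (B.guesser D hb₁ hb₂ (fun n => (p n).1) fun n => (p n).2)
  have hbest : ∀ n, F.guessProb B D n (p n).1 (p n).2 ≤ 1 / 2 + ε n := fun n =>
    le_of_eq_of_le (congrArg OQFE.average (funext fun r =>
      (B.probC_guesser D hb₁ hb₂ (fun n => (p n).1) (fun n => (p n).2) n (F.key n r) _).symm))
      (hguess n)
  refine Asymptotics.SuperpolynomialDecay.trans_abs_le (hε.const_mul 2) fun n => ?_
  rw [abs_abs]
  exact (OQFE.FunctionFamily.abs_acceptProb_sub_le B D n (ε n) fun δ s =>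
    (hp n δ s).trans (hbest n)).trans (le_abs_self _)
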